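/- Let $n\ge 3$ and let $A_n$ be the alternating group of degree $n$, acting on $\{1,\dots,n\}$. Let $T=\{(1,i,j),(1,j,i)\mid 2\le i<j\le n\}\subset A_n$, and let $EAG_n=\mathrm{Cay}(A_n,T)$ be the extended alternating group graph, that is, the simple graph with vertex set $A_n$ and edge set $\{\{\gamma,t\gamma\}\mid \gamma\in A_n,\ t\in T\}$, where a product $\sigma\tau$ of permutations means that $\sigma$ is applied first and $\tau$ second. Let $\lambda_1(EAG_n)\ge\lambda_2(EAG_n)\ge\cdots$ be the eigenvalues, with multiplicity, of the adjacency matrix of $EAG_n$. Then $$\lambda_1(EAG_n)=(n-1)(n-2)\qquad\text{and}\qquad \lambda_2(EAG_n)=n^2-5n+5.$$ In particular, the adjacency spectral gap $\lambda_1(EAG_n)-\lambda_2(EAG_n)$ of $EAG_n$ is $2n-3$. -/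

import Mathlib

/-- The `k`-th largest adjacency eigenvalue `λ_k(G)` of a finite simple graph `G`
(`1 ≤ k ≤ |V(G)|`): the eigenvalues of the real `0/1` adjacency matrix, repeated according to
multiplicity, are listed in nonincreasing order `λ_1(G) ≥ λ_2(G) ≥ ⋯`.
(Mathlib's `eigenvalues₀` is this list, indexed from `0`.) -/
noncomputable def adjEigenvalue {V : Type*} [Fintype V] [DecidableEq V] (G : SimpleGraph V)
    (k : ℕ) (hk : 1 ≤ k ∧ k ≤ Fintype.card V) : ℝ :=
  letI : DecidableRel G.Adj := Classical.decRel _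
  (G.isHermitian_adjMatrix ℝ).eigenvalues₀ ⟨k - 1, by omega⟩

/-- The adjacency spectral gap `λ_1(G) - λ_2(G)` of a graph with at least two vertices. -/
noncomputable def adjSpectralGap {V : Type*} [Fintype V] [DecidableEq V] (G : SimpleGraph V)
    (h : 2 ≤ Fintype.card V) : ℝ :=
  adjEigenvalue G 1 ⟨le_rfl, by omega⟩ - adjEigenvalue G 2 ⟨by omega, h⟩

/-- The set of 3-cycles `(1,i,j)`, `(1,j,i)` with `2 ≤ i < j ≤ n` in the alternating group of
degree `n`.  The points `1, …, n` are the elements of `Fin n`; the first point is the one of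
value `0`.  `[a, b, c].formPerm` is the cycle `a ↦ b ↦ c ↦ a`. -/
def eagGenerators (n : ℕ) : Set (alternatingGroup (Fin n)) :=
  {σ | ∃ o i j : Fin n, o.val = 0 ∧ o < i ∧ i < j ∧
    ((σ : Equiv.Perm (Fin n)) = [o, i, j].formPerm ∨
      (σ : Equiv.Perm (Fin n)) = [o, j, i].formPerm)}

/-- The extended alternating group graph `EAG_n`, a Cayley graph of the alternating group.
`SimpleGraph.mulCayley` joins `γ` to `γ * t` in Mathlib's product, in which `t` is applied first;
this is `tγ` when products of permutations are read from left to right. -/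
def EAG (n : ℕ) : SimpleGraph (alternatingGroup (Fin n)) :=
  SimpleGraph.mulCayley (eagGenerators n)

/-- `EAG_n` has at least two vertices for `n ≥ 3`. -/
theorem two_le_card_alternatingGroup {n : ℕ} (hn : 3 ≤ n) :
    2 ≤ Fintype.card (alternatingGroup (Fin n)) := by
  have : Nontrivial (Fin n) := Fin.nontrivial_iff_two_le.mpr (by omega)
  have h := two_mul_card_alternatingGroup (α := Fin n)
  rw [Fintype.card_perm, Fintype.card_fin] at h
  have h6 : Nat.factorial 3 ≤ Nat.factorial n := Nat.factorial_le hn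
  have h3 : Nat.factorial 3 = 6 := rfl
  omega

/-!
Let `J = ∑ j ≠ o, (o j)` be the Jucys–Murphy element of the symmetric group at the first point `o`,
acting on functions on `Perm (Fin n)` by right translations. In `J ^ 2` the products
`(o i)(o j)` with `i ≠ j` are exactly the generators of `EAG n`, and those with `i = j` add up to
`n - 1`. So `J ^ 2 - (n - 1)` preserves the functions supported on the even permutations, and acts
on them as the adjacency operator of `EAG n` (`adjMatrix_eag_mulVec_apply`).

The eigenvalues of `J` are integers of absolute value at most `n - 1`
(`exists_int_eq_of_hasEigenvalue_jucysMurphy`). This is proved by induction on the number of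
summands, with the relation `s X = Y s + 1` of the degenerate affine Hecke algebra between two
consecutive Jucys–Murphy elements `Y`, `X` and the transposition `s`. It works in every
finite-dimensional representation over an algebraically closed field, and needs neither the
classification of irreducible representations nor semisimplicity.

Hence every adjacency eigenvalue is `m ^ 2 - (n - 1)` for an integer `m` with `|m| ≤ n - 1`. The
value `|m| = n - 1` gives the degree `(n - 1)(n - 2)`, which belongs only to constant functions
because the graph is connected (`eq_of_forall_adj_eag`). All other eigenvalues are at most
`(n - 2) ^ 2 - (n - 1) = n ^ 2 - 5 n + 5`, and an explicit eigenfunction attains this bound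
(`exists_adjMatrix_eag_mulVec_eq`).
-/

open Equiv Module
open scoped Matrix

/-! ### Jucys–Murphy elements -/

theorem map_eq_self_of_forall_mem {α : Type*} {g : Perm α} {S : Finset α} (h : ∀ x ∈ S, g x ∈ S) :
    S.map g.toEmbedding = S := by
  refine Finset.eq_of_subset_of_card_le (fun y hy => ?_) (by simp)
  obtain ⟨x, hx, rfl⟩ := Finset.mem_map.1 hy
  exact h x hx

section JucysMurphy

variable {K α V : Type*} [Field K] [DecidableEq α] [AddCommGroup V] [Module K V]

/-- The action of the Jucys–Murphy element `∑ j ∈ S, (a j)` of the group algebra in a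
representation of the symmetric group. It is meant for `a ∉ S`, but no order on the points is
fixed, so that the usual elements are those in which `S` consists of the
points before `a`. -/
def jucysMurphy (ρ : Representation K (Perm α) V) (a : α) (S : Finset α) : End K V :=
  ∑ j ∈ S, ρ (swap a j)

variable (ρ : Representation K (Perm α) V)

theorem apply_mul_jucysMurphy (g : Perm α) (a : α) (S : Finset α) :
    ρ g * jucysMurphy ρ a S = jucysMurphy ρ (g a) (S.map g.toEmbedding) * ρ g := by
  simp only [jucysMurphy, Finset.mul_sum, Finset.sum_mul, Finset.sum_map]
  refine Finset.sum_congr rfl fun j _ => ?_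
  rw [← map_mul, ← map_mul]
  simp [swap_apply_apply]

theorem commute_jucysMurphy {a b : α} {S : Finset α} (hab : a ≠ b) (ha : a ∉ S) :
    Commute (jucysMurphy ρ b S) (jucysMurphy ρ a (insert b S)) := by
  refine Commute.sum_left _ _ _ fun i hi => ?_
  have hia : a ≠ i := fun h => ha (h ▸ hi)
  have h := apply_mul_jucysMurphy ρ (swap b i) a (insert b S)
  rw [swap_apply_of_ne_of_ne hab hia, map_eq_self_of_forall_mem] at h
  · exact h
  · intro x hx
    rw [swap_apply_def]
    split_ifs
    · exact Finset.mem_insert_of_mem hi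
    · exact Finset.mem_insert_self _ _
    · exact hx

theorem apply_swap_apply_swap (a b : α) (v : V) : ρ (swap a b) (ρ (swap a b) v) = v := by
  rw [← Module.End.mul_apply, ← map_mul, swap_mul_self, map_one, Module.End.one_apply]

/-- The relation of the degenerate affine Hecke algebra between consecutive Jucys–Murphy
elements. -/
theorem swap_mul_jucysMurphy_insert {a b : α} {S : Finset α} (ha : a ∉ S) (hb : b ∉ S) :
    ρ (swap a b) * jucysMurphy ρ a (insert b S) =
      jucysMurphy ρ b S * ρ (swap a b) + 1 := by
  have h := apply_mul_jucysMurphy ρ (swap a b) a S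
  rw [swap_apply_left, map_eq_self_of_forall_mem] at h
  · rw [jucysMurphy, Finset.sum_insert hb, mul_add, ← map_mul, swap_mul_self, map_one, add_comm]
    exact congrArg (· + 1) h
  · intro x hx
    rwa [swap_apply_of_ne_of_ne (by grind) (by grind)]

/-- The eigenvalues of a Jucys–Murphy element with `r` summands are integers of absolute value at
most `r`. For a common eigenvector `v` of two consecutive elements, with eigenvalues `c` and `μ`,
either `v` is an eigenvector of the transposition that relates them, and then `μ = c ± 1`, or a
combination of `v` and its image is an eigenvector of the smaller element for `μ`. -/
theorem exists_int_eq_of_hasEigenvalue_jucysMurphy [IsAlgClosed K] [FiniteDimensional K V]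
    {S : Finset α} {a : α} (ha : a ∉ S) {μ : K} (hμ : (jucysMurphy ρ a S).HasEigenvalue μ) :
    ∃ m : ℤ, |m| ≤ S.card ∧ μ = m := by
  induction S using Finset.induction_on generalizing a μ with
  | empty =>
    obtain ⟨v, hv⟩ := hμ.exists_hasEigenvector
    have h := hv.apply_eq_smul
    simp only [jucysMurphy, Finset.sum_empty, LinearMap.zero_apply] at h
    exact ⟨0, by simp, by simpa using (smul_eq_zero.1 h.symm).resolve_right hv.2⟩
  | insert b S hb ih =>
    rw [Finset.mem_insert, not_or] at ha
    obtain ⟨hab, haS⟩ := ha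
    rw [Finset.card_insert_of_notMem hb]
    set X := jucysMurphy ρ a (insert b S)
    set Y := jucysMurphy ρ b S
    set s := ρ (swap a b)
    -- `Y` commutes with `X`, so it has an eigenvector inside the `μ`-eigenspace of `X`.
    have hmaps : Set.MapsTo Y (X.eigenspace μ) (X.eigenspace μ) :=
      Module.End.mapsTo_genEigenspace_of_comm (commute_jucysMurphy ρ hab haS).symm μ 1
    have : Nontrivial (X.eigenspace μ) := Submodule.nontrivial_iff_ne_bot.2 hμ
    obtain ⟨c, hc⟩ := Module.End.exists_eigenvalue (Y.restrict hmaps)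
    obtain ⟨⟨v, hvX⟩, hv⟩ := hc.exists_hasEigenvector
    have hv0 : v ≠ 0 := fun h => hv.2 (Subtype.ext h)
    have hYv : Y v = c • v := congrArg Subtype.val hv.apply_eq_smul
    have hXv : X v = μ • v := Module.End.mem_eigenspace_iff.1 hvX
    obtain ⟨m, hm, rfl⟩ := ih hb (Module.End.hasEigenvalue_of_hasEigenvector
      ⟨Module.End.mem_eigenspace_iff.2 hYv, hv0⟩)
    by_cases hμm : μ = m
    · exact ⟨m, by push_cast; omega, hμm⟩
    have hd : μ - m ≠ 0 := sub_ne_zero.2 hμm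
    have hYs : Y (s v) = μ • s v - v := by
      have h := LinearMap.congr_fun (swap_mul_jucysMurphy_insert ρ haS hb) v
      change s (X v) = Y (s v) + v at h
      rw [eq_sub_iff_add_eq, ← h, hXv, map_smul]
    -- `s v - (μ - m)⁻¹ • v` lies in the `μ`-eigenspace of `Y`; if it vanishes, `(μ - m)⁻¹ = ±1`,
    -- because `s` is an involution.
    by_cases hw : s v - (μ - m)⁻¹ • v = 0
    · have hsv : s v = (μ - m)⁻¹ • v := sub_eq_zero.1 hw
      have hss : v = ((μ - m)⁻¹ * (μ - m)⁻¹) • v := by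
        conv_lhs => rw [← apply_swap_apply_swap ρ a b v]
        change s (s v) = _
        rw [hsv, map_smul, hsv, smul_smul]
      have h1 : (μ - m)⁻¹ * (μ - m)⁻¹ = 1 := by
        have : ((μ - m)⁻¹ * (μ - m)⁻¹ - 1) • v = 0 := by
          rw [sub_smul, one_smul, ← hss, sub_self]
        exact sub_eq_zero.1 ((smul_eq_zero.1 this).resolve_right hv0)
      have habs := abs_le.1 hm
      rcases mul_self_eq_one_iff.1 h1 with h | h
      · refine ⟨m + 1, abs_le.2 ⟨by push_cast; omega, by push_cast; omega⟩, ?_⟩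
        rw [inv_eq_one] at h
        push_cast
        linear_combination h
      · refine ⟨m - 1, abs_le.2 ⟨by push_cast; omega, by push_cast; omega⟩, ?_⟩
        rw [inv_eq_iff_eq_inv, inv_neg, inv_one] at h
        push_cast
        linear_combination h
    · have hY : Y (s v - (μ - m)⁻¹ • v) = μ • (s v - (μ - m)⁻¹ • v) := by
        rw [map_sub, map_smul, hYs, hYv]
        have h : (μ - m)⁻¹ * μ = 1 + (μ - m)⁻¹ * m := by
          field_simp
          ring
        rw [smul_sub, smul_smul, smul_smul, mul_comm μ, h, add_smul, one_smul]
        abel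
      obtain ⟨k, hk, hμk⟩ := ih hb (Module.End.hasEigenvalue_of_hasEigenvector
        ⟨Module.End.mem_eigenspace_iff.2 hY, hw⟩)
      exact ⟨k, by push_cast; omega, hμk⟩

/-- An eigenvalue of `X ^ 2` is the square of an eigenvalue of `X`, because
`X ^ 2 - r ^ 2 = (X - r) (X + r)`. -/
theorem exists_hasEigenvalue_mul_self_eq [IsAlgClosed K] {X : End K V} {v : V} {ν : K}
    (hv : v ≠ 0) (h : X (X v) = ν • v) : ∃ r, r * r = ν ∧ X.HasEigenvalue r := by
  obtain ⟨r, rfl⟩ := IsAlgClosed.exists_eq_mul_self ν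
  by_cases hu : X v + r • v = 0
  · refine ⟨-r, by ring, Module.End.hasEigenvalue_of_hasEigenvector
      ⟨Module.End.mem_eigenspace_iff.2 ?_, hv⟩⟩
    rw [neg_smul]
    exact eq_neg_of_add_eq_zero_left hu
  · refine ⟨r, rfl, Module.End.hasEigenvalue_of_hasEigenvector
      ⟨Module.End.mem_eigenspace_iff.2 ?_, hu⟩⟩
    rw [map_add, map_smul, h, smul_add, smul_smul, add_comm]

end JucysMurphy

/-- The right regular representation of a group on the functions on it. -/
def rightRegular (K G : Type*) [Field K] [Group G] : Representation K G (G → K) where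
  toFun g :=
    { toFun := fun F h => F (h * g)
      map_add' := fun _ _ => rfl
      map_smul' := fun _ _ => rfl }
  map_one' := by ext; simp
  map_mul' g g' := by ext; simp [mul_assoc]

theorem jucysMurphy_rightRegular_apply {K α : Type*} [Field K] [DecidableEq α] (a : α)
    (S : Finset α) (F : Perm α → K) (g : Perm α) :
    jucysMurphy (rightRegular K (Perm α)) a S F g = ∑ j ∈ S, F (g * swap a j) := by
  simp [jucysMurphy, rightRegular, LinearMap.sum_apply, Finset.sum_apply]

/-- The square of the Jucys–Murphy element is the sum of the 3-cycles `(a i)(a j)`, plus one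
identity for each of the products with `i = j`. -/
theorem jucysMurphy_rightRegular_sq_apply {K α : Type*} [Field K] [DecidableEq α] (a : α)
    (S : Finset α) (F : Perm α → K) (g : Perm α) :
    jucysMurphy (rightRegular K (Perm α)) a S (jucysMurphy (rightRegular K (Perm α)) a S F) g =
      S.card * F g + ∑ p ∈ S.offDiag, F (g * (swap a p.1 * swap a p.2)) := by
  simp only [jucysMurphy_rightRegular_apply]
  rw [← Finset.sum_product', ← Finset.diag_union_offDiag,
    Finset.sum_union (Finset.disjoint_diag_offDiag S), Finset.sum_diag]
  simp [mul_assoc]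

/-! ### The largest two eigenvalues of a symmetric matrix -/

section Spectrum

variable {V : Type*} [Fintype V] [DecidableEq V] {A : Matrix V V ℝ} (hA : A.IsHermitian)

theorem exists_mulVec_eq_eigenvalues₀_smul (k : Fin (Fintype.card V)) :
    ∃ f : V → ℝ, f ≠ 0 ∧ A *ᵥ f = hA.eigenvalues₀ k • f := by
  have h := (Matrix.isSymmetric_toEuclideanLin_iff.mpr hA).hasEigenvector_eigenvectorBasis
    finrank_euclideanSpace k
  exact ⟨_, fun h0 => h.2 ((WithLp.ofLp_eq_zero 2).1 h0),
    congrArg WithLp.ofLp h.apply_eq_smul⟩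

theorem exists_eigenvalues₀_eq_of_mulVec_eq {f : V → ℝ} {μ : ℝ} (hf : f ≠ 0)
    (h : A *ᵥ f = μ • f) : ∃ k, hA.eigenvalues₀ k = μ := by
  refine (Matrix.isSymmetric_toEuclideanLin_iff.mpr hA).exists_eigenvalues_eq finrank_euclideanSpace
    (Module.End.hasEigenvalue_of_hasEigenvector
      (x := WithLp.toLp 2 f) ⟨Module.End.mem_eigenspace_iff.2 ?_, ?_⟩)
  · exact congrArg (WithLp.toLp 2) h
  · exact fun h0 => hf ((WithLp.toLp_eq_zero 2).1 h0)

/-- An eigenvalue whose eigenspace is contained in a line occurs at most once in the list of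
eigenvalues. -/
theorem eq_of_eigenvalues₀_eq {h : V → ℝ} {μ : ℝ}
    (hμ : ∀ f : V → ℝ, A *ᵥ f = μ • f → ∃ c : ℝ, f = c • h) {k l : Fin (Fintype.card V)}
    (hk : hA.eigenvalues₀ k = μ) (hl : hA.eigenvalues₀ l = μ) : k = l := by
  by_contra hkl
  have hT := Matrix.isSymmetric_toEuclideanLin_iff.mpr hA
  set b := hT.eigenvectorBasis finrank_euclideanSpace
  have key : ∀ i, hA.eigenvalues₀ i = μ → ∃ c : ℝ, b i = c • WithLp.toLp 2 h := by
    intro i hi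
    obtain ⟨c, hc⟩ := hμ (b i) (by
      rw [← hi]
      exact congrArg WithLp.ofLp (hT.hasEigenvector_eigenvectorBasis
        finrank_euclideanSpace i).apply_eq_smul)
    exact ⟨c, congrArg (WithLp.toLp 2) hc⟩
  obtain ⟨c, hc⟩ := key k hk
  obtain ⟨d, hd⟩ := key l hl
  have h0 : inner ℝ (b k) (b l) = 0 := b.orthonormal.2 hkl
  have hbk : b k ≠ 0 := b.orthonormal.ne_zero k
  have hbl : b l ≠ 0 := b.orthonormal.ne_zero l
  rw [hc] at hbk h0
  rw [hd] at hbl h0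
  rw [inner_smul_left, inner_smul_right] at h0
  simp_all

/-- If `a > b` are eigenvalues, no other eigenvalue exceeds `b`, and the eigenspace of `a` is
contained in a line, then `a` and `b` are the first two entries of the list of eigenvalues. -/
theorem eigenvalues₀_zero_and_one {a b : ℝ} (hab : b < a)
    (hle : ∀ (f : V → ℝ) (μ : ℝ), f ≠ 0 → A *ᵥ f = μ • f → μ = a ∨ μ ≤ b)
    {h f : V → ℝ} (hh : h ≠ 0) (hAh : A *ᵥ h = a • h) (hf : f ≠ 0) (hAf : A *ᵥ f = b • f)
    (hline : ∀ u : V → ℝ, A *ᵥ u = a • u → ∃ c : ℝ, u = c • h)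
    (h0 : 0 < Fintype.card V) (h1 : 1 < Fintype.card V) :
    hA.eigenvalues₀ ⟨0, h0⟩ = a ∧ hA.eigenvalues₀ ⟨1, h1⟩ = b := by
  have hor : ∀ k, hA.eigenvalues₀ k = a ∨ hA.eigenvalues₀ k ≤ b := fun k => by
    obtain ⟨u, hu, hAu⟩ := exists_mulVec_eq_eigenvalues₀_smul hA k
    exact hle u _ hu hAu
  obtain ⟨i, hi⟩ := exists_eigenvalues₀_eq_of_mulVec_eq hA hh hAh
  obtain ⟨j, hj⟩ := exists_eigenvalues₀_eq_of_mulVec_eq hA hf hAf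
  have hzero : hA.eigenvalues₀ ⟨0, h0⟩ = a := by
    have := hA.eigenvalues₀_antitone (show (⟨0, h0⟩ : Fin _) ≤ i from Nat.zero_le _)
    rcases hor ⟨0, h0⟩ with h | h
    · exact h
    · linarith
  refine ⟨hzero, ?_⟩
  have hj0 : j.val ≠ 0 := fun h => by
    have : j = ⟨0, h0⟩ := Fin.ext h
    rw [this, hzero] at hj
    exact hab.ne' hj
  have hge := hA.eigenvalues₀_antitone
    (show (⟨1, h1⟩ : Fin _) ≤ j from Nat.one_le_iff_ne_zero.2 hj0)
  rcases hor ⟨1, h1⟩ with h | h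
  · have := eq_of_eigenvalues₀_eq hA hline hzero h
    simp at this
  · linarith

end Spectrum

/-! ### The extended alternating group graph -/

section EAG

variable {n : ℕ} {o : Fin n}

theorem swap_mul_swap_mem_alternatingGroup {i j : Fin n} (hi : o ≠ i) (hj : o ≠ j) :
    swap o i * swap o j ∈ alternatingGroup (Fin n) := by
  rw [Perm.mem_alternatingGroup, Perm.sign_mul, Perm.sign_swap hi, Perm.sign_swap hj]
  rfl

theorem formPerm_cons_cons_singleton {i j : Fin n} (hj : o ≠ j) (hij : i ≠ j) :
    [o, i, j].formPerm = swap o j * swap o i := by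
  have h := swap_apply_apply (swap o i) i j
  rw [swap_apply_right, swap_apply_of_ne_of_ne hj.symm hij.symm, swap_inv] at h
  rw [List.formPerm_cons_cons, List.formPerm_pair, h, mul_assoc, swap_mul_self, mul_one]

theorem mem_eagGenerators_iff (ho : o.val = 0) {σ : alternatingGroup (Fin n)} :
    σ ∈ eagGenerators n ↔ ∃ i j : Fin n, o ≠ i ∧ o ≠ j ∧ i ≠ j ∧
      (σ : Perm (Fin n)) = swap o i * swap o j := by
  have hlt : ∀ {i : Fin n}, o < i ↔ o ≠ i := fun {i} => by
    rw [Fin.lt_def, ne_eq, Fin.ext_iff]; omega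
  constructor
  · rintro ⟨o', i, j, ho', hi, hij, h⟩
    obtain rfl : o' = o := Fin.ext (ho'.trans ho.symm)
    have hi' := hi.ne
    have hj' := (hi.trans hij).ne
    rcases h with h | h
    · exact ⟨j, i, hj', hi', hij.ne', h.trans (formPerm_cons_cons_singleton hj' hij.ne)⟩
    · exact ⟨i, j, hi', hj', hij.ne, h.trans (formPerm_cons_cons_singleton hi' hij.ne')⟩
  · rintro ⟨i, j, hi, hj, hij, h⟩
    rcases lt_or_gt_of_ne hij with hlt' | hlt'
    · exact ⟨o, i, j, ho, hlt.2 hi, hlt',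
        Or.inr (h.trans (formPerm_cons_cons_singleton hi hij.symm).symm)⟩
    · exact ⟨o, j, i, ho, hlt.2 hj, hlt',
        Or.inl (h.trans (formPerm_cons_cons_singleton hi hij.symm).symm)⟩

theorem swap_mul_swap_ne_one {i j : Fin n} (hij : i ≠ j) : swap o i * swap o j ≠ 1 := by
  intro h
  have := mul_eq_one_iff_eq_inv.1 h
  rw [swap_inv] at this
  exact hij (by simpa using congrArg (· o) this)

theorem eag_adj_iff (ho : o.val = 0) {γ δ : alternatingGroup (Fin n)} :
    (EAG n).Adj γ δ ↔ ∃ i j : Fin n, o ≠ i ∧ o ≠ j ∧ i ≠ j ∧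
      (δ : Perm (Fin n)) = γ * (swap o i * swap o j) := by
  rw [EAG, SimpleGraph.mulCayley_adj']
  constructor
  · rintro ⟨-, t, ht, h⟩
    obtain ⟨i, j, hi, hj, hij, ht'⟩ := (mem_eagGenerators_iff ho).1 ht
    rcases h with rfl | rfl
    · exact ⟨i, j, hi, hj, hij, by simp [ht']⟩
    · exact ⟨j, i, hj, hi, hij.symm, by simp [ht', mul_assoc]⟩
  · rintro ⟨i, j, hi, hj, hij, h⟩
    refine ⟨?_, ⟨_, swap_mul_swap_mem_alternatingGroup hi hj⟩,
      (mem_eagGenerators_iff ho).2 ⟨i, j, hi, hj, hij, rfl⟩, Or.inl (Subtype.ext h.symm)⟩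
    rintro rfl
    exact swap_mul_swap_ne_one hij (by simpa using h)

theorem sum_neighborFinset_eag {M : Type*} [AddCommMonoid M] [DecidableRel (EAG n).Adj]
    (ho : o.val = 0) (γ : alternatingGroup (Fin n)) (F : Perm (Fin n) → M) :
    ∑ δ ∈ (EAG n).neighborFinset γ, F δ =
      ∑ p ∈ (Finset.univ.erase o).offDiag, F (γ * (swap o p.1 * swap o p.2)) := by
  symm
  have hp : ∀ p ∈ (Finset.univ.erase o).offDiag, o ≠ p.1 ∧ o ≠ p.2 ∧ p.1 ≠ p.2 := by
    intro p hp
    simp only [Finset.mem_offDiag, Finset.mem_erase, Finset.mem_univ, and_true] at hp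
    exact ⟨hp.1.symm, hp.2.1.symm, hp.2.2⟩
  refine Finset.sum_bij
    (fun p h => γ * ⟨_, swap_mul_swap_mem_alternatingGroup (hp p h).1 (hp p h).2.1⟩)
    ?_ ?_ ?_ ?_
  · intro p h
    rw [SimpleGraph.mem_neighborFinset, eag_adj_iff ho]
    exact ⟨p.1, p.2, (hp p h).1, (hp p h).2.1, (hp p h).2.2, rfl⟩
  · intro p h q h' hpq
    have heq : swap o p.1 * swap o p.2 = swap o q.1 * swap o q.2 :=
      congrArg Subtype.val (mul_left_cancel hpq)
    have h2 : p.2 = q.2 := by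
      have := congrArg (· o) heq
      simpa [swap_apply_of_ne_of_ne (hp p h).2.1.symm (hp p h).2.2.symm,
        swap_apply_of_ne_of_ne (hp q h').2.1.symm (hp q h').2.2.symm] using this
    rw [h2] at heq
    exact Prod.ext (by simpa using congrArg (· o) (mul_right_cancel heq)) h2
  · intro δ hδ
    rw [SimpleGraph.mem_neighborFinset, eag_adj_iff ho] at hδ
    obtain ⟨i, j, hi, hj, hij, h⟩ := hδ
    exact ⟨(i, j), by simp [hi.symm, hj.symm, hij], Subtype.ext h.symm⟩
  · intro p h
    rfl

/-- On the even permutations the adjacency operator is the square of the Jucys–Murphy operator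
minus `n - 1`. -/
theorem adjMatrix_eag_mulVec_apply {K : Type*} [Field K] [DecidableRel (EAG n).Adj]
    (ho : o.val = 0) (γ : alternatingGroup (Fin n)) (F : Perm (Fin n) → K) :
    ((EAG n).adjMatrix K *ᵥ fun δ => F δ) γ =
      jucysMurphy (rightRegular K (Perm (Fin n))) o (Finset.univ.erase o)
        (jucysMurphy (rightRegular K (Perm (Fin n))) o (Finset.univ.erase o) F) γ
        - ((n : K) - 1) * F γ := by
  have hn : 1 ≤ n := by have := o.isLt; omega
  rw [SimpleGraph.adjMatrix_mulVec_apply, sum_neighborFinset_eag ho,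
    jucysMurphy_rightRegular_sq_apply, Finset.card_erase_of_mem (Finset.mem_univ o),
    Finset.card_univ, Fintype.card_fin, Nat.cast_sub hn, Nat.cast_one]
  ring

/-- An eigenfunction of the adjacency matrix, extended by zero to the odd permutations, is an
eigenfunction of the square of the Jucys–Murphy operator. -/
theorem exists_int_of_adjMatrix_eag_mulVec_eq [DecidableRel (EAG n).Adj] (ho : o.val = 0)
    {f : alternatingGroup (Fin n) → ℝ} {μ : ℝ} (hf : f ≠ 0)
    (h : (EAG n).adjMatrix ℝ *ᵥ f = μ • f) :
    ∃ m : ℤ, |m| ≤ (n : ℤ) - 1 ∧ μ = (m : ℝ) ^ 2 - ((n : ℝ) - 1) := by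
  have hn : 1 ≤ n := by have := o.isLt; omega
  classical
  let F : Perm (Fin n) → ℂ := fun g =>
    if hg : g ∈ alternatingGroup (Fin n) then (f ⟨g, hg⟩ : ℂ) else 0
  have hFγ : ∀ γ : alternatingGroup (Fin n), F γ = f γ := fun γ => dif_pos γ.2
  have hF : F ≠ 0 := fun h0 => hf <| funext fun γ => by
    have := congrFun h0 γ
    rw [hFγ] at this
    exact Complex.ofReal_eq_zero.1 this
  have hJ : jucysMurphy (rightRegular ℂ (Perm (Fin n))) o (Finset.univ.erase o)
      (jucysMurphy (rightRegular ℂ (Perm (Fin n))) o (Finset.univ.erase o) F) =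
        ((μ : ℂ) + ((n : ℂ) - 1)) • F := by
    funext g
    by_cases hg : g ∈ alternatingGroup (Fin n)
    · have h1 := adjMatrix_eag_mulVec_apply ho ⟨g, hg⟩ F
      have h2 : ((EAG n).adjMatrix ℂ *ᵥ fun δ => F δ) ⟨g, hg⟩ = μ * F g := by
        have h3 := congrFun h ⟨g, hg⟩
        rw [SimpleGraph.adjMatrix_mulVec_apply, Pi.smul_apply, smul_eq_mul] at h3
        rw [SimpleGraph.adjMatrix_mulVec_apply, hFγ ⟨g, hg⟩, ← Complex.ofReal_mul, ← h3,
          Complex.ofReal_sum]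
        exact Finset.sum_congr rfl fun δ _ => hFγ δ
      rw [Pi.smul_apply, smul_eq_mul]
      linear_combination h2 - h1
    · rw [jucysMurphy_rightRegular_sq_apply, Finset.sum_eq_zero]
      · rw [Pi.smul_apply, show F g = 0 from dif_neg hg, mul_zero, smul_zero, add_zero]
      · intro p hp
        simp only [Finset.mem_offDiag, Finset.mem_erase, Finset.mem_univ, and_true] at hp
        refine dif_neg fun h' => hg ?_
        exact (Subgroup.mul_mem_cancel_right _
          (swap_mul_swap_mem_alternatingGroup hp.1.symm hp.2.1.symm)).1 h'
  obtain ⟨r, hr, hev⟩ := exists_hasEigenvalue_mul_self_eq hF hJ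
  obtain ⟨m, hm, rfl⟩ := exists_int_eq_of_hasEigenvalue_jucysMurphy _ (by simp) hev
  refine ⟨m, ?_, ?_⟩
  · rwa [Finset.card_erase_of_mem (Finset.mem_univ o), Finset.card_univ, Fintype.card_fin,
      Nat.cast_sub hn, Nat.cast_one] at hm
  · have : ((m : ℝ) : ℂ) * (m : ℝ) = (μ : ℂ) + ((n : ℝ) - 1) := by exact_mod_cast hr
    have : (m : ℝ) * m = μ + (n - 1) := by exact_mod_cast this
    linarith

/-- The graph is connected, because its generators generate the alternating group: a 3-cycle that
moves `o` is a product of two star transpositions, and any other 3-cycle is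
`(b a)(b c) = (o b)(o a) (o c)(o b)`. -/
theorem eq_of_forall_adj_eag (ho : o.val = 0) {β : Type*} {f : alternatingGroup (Fin n) → β}
    (hf : ∀ γ δ, (EAG n).Adj γ δ → f γ = f δ) (γ : alternatingGroup (Fin n)) : f γ = f 1 := by
  have hgen : alternatingGroup (Fin n) ≤ Subgroup.closure
      {σ | ∃ i j : Fin n, o ≠ i ∧ o ≠ j ∧ i ≠ j ∧ σ = swap o i * swap o j} := by
    rw [← Perm.closure_three_cycles_eq_alternating, Subgroup.closure_le]
    intro σ hσ
    obtain ⟨a, ha⟩ : σ.support.Nonempty := Finset.nonempty_iff_ne_empty.2 fun h =>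
      hσ.ne_one (Perm.support_eq_empty_iff.1 h)
    have hnd := hσ.nodup_iff_mem_support.2 ha
    have hσ' := hσ.eq_swap_mul_swap_iff_mem_support.2 ha
    -- With `a` moved by `σ`, the 3-cycle `σ` is `(a b)(b c)` for `b = σ a` and `c = σ b`.
    generalize σ a = b at hnd hσ'
    generalize σ b = c at hnd hσ'
    subst hσ'
    have hab : a ≠ b := by grind
    have hac : a ≠ c := by grind
    have hbc : b ≠ c := by grind
    have hmem : ∀ {i j : Fin n}, o ≠ i → o ≠ j → i ≠ j → swap o i * swap o j ∈
        Subgroup.closure {σ : Perm (Fin n) | ∃ i j : Fin n, o ≠ i ∧ o ≠ j ∧ i ≠ j ∧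
          σ = swap o i * swap o j} :=
      fun {i j} hi hj hij => Subgroup.subset_closure ⟨i, j, hi, hj, hij, rfl⟩
    rw [SetLike.mem_coe]
    by_cases hob : o = b
    · subst hob
      rw [swap_comm a]
      exact hmem hab.symm hbc hac
    have hconj : ∀ {x : Fin n}, o ≠ x → x ≠ b →
        swap b x = swap o b * swap o x * swap o b := fun {x} hox hxb => by
      rw [swap_comm o x, swap_mul_swap_mul_swap hox.symm hxb]
    rw [swap_comm a b]
    by_cases hoa : o = a
    · subst hoa
      rw [hconj hac hbc.symm, ← mul_assoc, ← mul_assoc, swap_comm b, swap_mul_self, one_mul]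
      exact hmem hac hab hbc.symm
    rw [hconj hoa hab]
    by_cases hoc : o = c
    · subst hoc
      rw [swap_comm b o, mul_assoc, swap_mul_self, mul_one]
      exact hmem hob hoa hab.symm
    have h : swap o b * swap o a * swap o b * (swap o b * swap o c * swap o b) =
        swap o b * swap o a * (swap o c * swap o b) := by
      simp [mul_assoc]
    rw [hconj hoc hbc.symm, h]
    exact mul_mem (hmem hob hoa hab.symm) (hmem hoc hob hbc.symm)
  obtain ⟨g, hg⟩ := γ
  have key : ∃ hg' : g ∈ alternatingGroup (Fin n), f ⟨g, hg'⟩ = f 1 := by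
    have hcl := hgen hg
    clear hg
    induction hcl using Subgroup.closure_induction_right with
    | one => exact ⟨one_mem _, rfl⟩
    | mul_right x hx y hy ih =>
      obtain ⟨i, j, hi, hj, hij, rfl⟩ := hy
      obtain ⟨hx', ih⟩ := ih
      refine ⟨mul_mem hx' (swap_mul_swap_mem_alternatingGroup hi hj), ih ▸ ?_⟩
      exact (hf _ _ ((eag_adj_iff ho).2 ⟨i, j, hi, hj, hij, rfl⟩)).symm
    | mul_inv_cancel x hx y hy ih =>
      obtain ⟨i, j, hi, hj, hij, rfl⟩ := hy
      obtain ⟨hx', ih⟩ := ih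
      refine ⟨mul_mem hx' (inv_mem (swap_mul_swap_mem_alternatingGroup hi hj)), ih ▸ ?_⟩
      exact (hf _ _ ((eag_adj_iff ho).2 ⟨j, i, hj, hi, hij.symm, by simp [mul_inv_rev]⟩)).symm
  exact key.2

theorem adjMatrix_eag_mulVec_one [DecidableRel (EAG n).Adj] (ho : o.val = 0) :
    (EAG n).adjMatrix ℝ *ᵥ (fun _ => 1) = (((n : ℝ) - 1) * ((n : ℝ) - 2)) • fun _ => 1 := by
  have hn : 1 ≤ n := by have := o.isLt; omega
  funext γ
  have h := adjMatrix_eag_mulVec_apply (K := ℝ) ho γ (fun _ => 1)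
  rw [h]
  simp only [jucysMurphy_rightRegular_apply, Finset.sum_const, Pi.smul_apply, smul_eq_mul,
    Finset.card_erase_of_mem (Finset.mem_univ o), Finset.card_univ, Fintype.card_fin,
    nsmul_eq_mul, Nat.cast_sub hn, Nat.cast_one]
  ring

theorem eq_smul_one_of_adjMatrix_eag_mulVec_eq [DecidableRel (EAG n).Adj] (ho : o.val = 0)
    {f : alternatingGroup (Fin n) → ℝ}
    (h : (EAG n).adjMatrix ℝ *ᵥ f = (((n : ℝ) - 1) * ((n : ℝ) - 2)) • f) :
    ∃ c : ℝ, f = c • fun _ => 1 := by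
  have hlap : (EAG n).lapMatrix ℝ *ᵥ f = 0 := by
    funext γ
    have hdeg := congrFun (adjMatrix_eag_mulVec_one (n := n) ho) γ
    have hγ := congrFun h γ
    rw [SimpleGraph.adjMatrix_mulVec_apply] at hdeg hγ
    rw [SimpleGraph.lapMatrix_mulVec_apply, hγ]
    simp only [Finset.sum_const, SimpleGraph.card_neighborFinset_eq_degree, nsmul_eq_mul,
      Pi.smul_apply, smul_eq_mul, mul_one] at hdeg ⊢
    rw [hdeg, sub_self, Pi.zero_apply]
  rw [SimpleGraph.lapMatrix_mulVec_eq_zero_iff_forall_adj] at hlap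
  exact ⟨f 1, funext fun γ => by simp [eq_of_forall_adj_eag ho hlap γ]⟩

theorem sum_comp_swap_apply {K : Type*} [Field K] {x : Fin n} (hx : o ≠ x) (w : Fin n → K) :
    ∑ j ∈ Finset.univ.erase o, w (swap o j x) = ((n : K) - 2) * w x + w o := by
  have hxm : x ∈ Finset.univ.erase o := by simp [hx.symm]
  have hn : 2 ≤ n := by
    have := Fin.val_ne_of_ne hx
    omega
  rw [← Finset.sum_erase_add _ _ hxm, swap_apply_right, Finset.sum_congr rfl fun j hj => by
    rw [swap_apply_of_ne_of_ne hx.symm (Finset.ne_of_mem_erase hj).symm],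
    Finset.sum_const, Finset.card_erase_of_mem hxm, Finset.card_erase_of_mem (Finset.mem_univ o),
    Finset.card_univ, Fintype.card_fin, nsmul_eq_mul, Nat.sub_sub, Nat.cast_sub hn]
  norm_num

/-- The eigenfunction comes from the natural permutation representation, in which the vector
`e_x - e_y` is multiplied by `n - 2` when the Jucys–Murphy element acts. -/
theorem exists_adjMatrix_eag_mulVec_eq [DecidableRel (EAG n).Adj] (ho : o.val = 0) (hn : 3 ≤ n) :
    ∃ f : alternatingGroup (Fin n) → ℝ, f ≠ 0 ∧
      (EAG n).adjMatrix ℝ *ᵥ f = ((n : ℝ) ^ 2 - 5 * (n : ℝ) + 5) • f := by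
  obtain ⟨x, y, hx, hy, hxy⟩ : ∃ x y : Fin n, o ≠ x ∧ o ≠ y ∧ x ≠ y :=
    ⟨⟨1, by omega⟩, ⟨2, by omega⟩, by simp [Fin.ext_iff, ho], by simp [Fin.ext_iff, ho], by simp⟩
  let F : Perm (Fin n) → ℝ := fun g =>
    (Pi.single o 1 : Fin n → ℝ) (g x) - (Pi.single o 1 : Fin n → ℝ) (g y)
  have hJ : jucysMurphy (rightRegular ℝ (Perm (Fin n))) o (Finset.univ.erase o) F =
      ((n : ℝ) - 2) • F := by
    funext g
    rw [jucysMurphy_rightRegular_apply, Pi.smul_apply, smul_eq_mul, Finset.sum_sub_distrib]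
    have h1 := sum_comp_swap_apply hx fun z => (Pi.single o 1 : Fin n → ℝ) (g z)
    have h2 := sum_comp_swap_apply hy fun z => (Pi.single o 1 : Fin n → ℝ) (g z)
    simp only [Perm.coe_mul, Function.comp_apply, h1, h2, F]
    ring
  refine ⟨fun γ => F γ, fun h0 => ?_, ?_⟩
  · have := congrFun h0 ⟨_, swap_mul_swap_mem_alternatingGroup hx hy⟩
    simp [F, hx, swap_apply_of_ne_of_ne hx.symm hxy] at this
  · funext γ
    rw [adjMatrix_eag_mulVec_apply ho γ F, hJ, map_smul, hJ]
    simp only [Pi.smul_apply, smul_eq_mul]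
    ring

end EAG

theorem theorem2 (n : ℕ) (hn : 3 ≤ n) :
    adjEigenvalue (EAG n) 1 ⟨le_rfl, le_trans one_le_two (two_le_card_alternatingGroup hn)⟩
        = ((n : ℝ) - 1) * ((n : ℝ) - 2) ∧
      adjEigenvalue (EAG n) 2 ⟨one_le_two, two_le_card_alternatingGroup hn⟩
        = (n : ℝ) ^ 2 - 5 * (n : ℝ) + 5 ∧
      adjSpectralGap (EAG n) (two_le_card_alternatingGroup hn) = 2 * (n : ℝ) - 3 := by
  let : DecidableRel (EAG n).Adj := Classical.decRel _
  have ho : (⟨0, by omega⟩ : Fin n).val = 0 := rfl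
  have hn' : (3 : ℝ) ≤ n := by exact_mod_cast hn
  have hcard := two_le_card_alternatingGroup hn
  obtain ⟨f, hf, hAf⟩ := exists_adjMatrix_eag_mulVec_eq ho hn
  obtain ⟨h1, h2⟩ := eigenvalues₀_zero_and_one ((EAG n).isHermitian_adjMatrix ℝ)
    (by nlinarith : (n : ℝ) ^ 2 - 5 * (n : ℝ) + 5 < ((n : ℝ) - 1) * ((n : ℝ) - 2))
    (fun u μ hu hAu => by
      obtain ⟨m, hm, rfl⟩ := exists_int_of_adjMatrix_eag_mulVec_eq ho hu hAu
      rw [← sq_abs]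
      rcases hm.eq_or_lt with h | h
      · left
        have : |(m : ℝ)| = n - 1 := by exact_mod_cast h
        rw [this]
        ring
      · right
        have : |(m : ℝ)| ≤ n - 2 := by
          have : |m| ≤ (n : ℤ) - 2 := by omega
          exact_mod_cast this
        nlinarith [abs_nonneg (m : ℝ)])
    (h := fun _ => 1) (fun h0 => one_ne_zero (congrFun h0 1)) (adjMatrix_eag_mulVec_one ho) hf hAf
    (fun u hu => eq_smul_one_of_adjMatrix_eag_mulVec_eq ho hu) (by omega) (by omega)
  have h1' : adjEigenvalue (EAG n) 1
      ⟨le_rfl, le_trans one_le_two (two_le_card_alternatingGroup hn)⟩ = _ := h1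
  have h2' : adjEigenvalue (EAG n) 2 ⟨one_le_two, two_le_card_alternatingGroup hn⟩ = _ := h2
  refine ⟨h1', h2', ?_⟩
  rw [adjSpectralGap, h1', h2']
  ring
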